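/- Let $k\ge 1$. Let $\mathcal{L}_k^\infty$ be the field of formal series $f=\sum a_{\alpha,n_1,\dots,n_k}\,z^{\alpha}\boldsymbol{\ell}_1^{n_1}\cdots\boldsymbol{\ell}_k^{n_k}$ with real coefficients whose support in $\mathbb{R}\times\mathbb{Z}^k$ is well-ordered for the lexicographic order, where $\boldsymbol{\ell}_1=-1/\log z$ and $\boldsymbol{\ell}_{j+1}=-1/\log\boldsymbol{\ell}_j$. Let $\mathrm{ord}(f)$ be the least element of the support of $f$, with $\mathrm{ord}(0)=\infty$ (larger than every element of $\mathbb{R}\times\mathbb{Z}^k$, and $\infty-a=\infty$). Let $\mathcal{B}_{\ge 1}^{+}\subseteq\mathcal{L}_k^\infty$ be the set of those $f$ in which only the exponent $\alpha=0$ of $z$ occurs and for which $\mathrm{ord}(f)>(0,0,\dots,0)$. Let $D_1=\boldsymbol{\ell}_1^2\,\frac{d}{d\boldsymbol{\ell}_1}$, acting term by term, so that $$D_1\big(\boldsymbol{\ell}_1^{n_1}\cdots\boldsymbol{\ell}_k^{n_k}\big)=\boldsymbol{\ell}_1^{n_1}\cdots\boldsymbol{\ell}_k^{n_k}\sum_{j=1}^{k}n_j\,\boldsymbol{\ell}_1\cdots\boldsymbol{\ell}_j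 ,$$ and let $\mathbf{1}_k=(1,\dots,1)\in\mathbb{Z}^k$. **Proposition.** Let $K,M,N,T\in\mathcal{B}_{\ge 1}^{+}$ with $N\ne 0$, $\mathrm{ord}(T)\ge\mathrm{ord}\big(\tfrac{D_1(N)}{N}\big)$, $\mathrm{ord}(K)>(0,\mathbf{1}_k)$ and $\mathrm{ord}(M)-\mathrm{ord}(N)>(0,\mathbf{1}_k)$. Let $h\in\mathbb{R}[[x]]$ be a formal power series with $h(0)=h'(0)=0$. Then there is exactly one $S\in\mathcal{B}_{\ge 1}^{+}$ with $\mathrm{ord}(S)>\mathrm{ord}(N)$ such that $$D_1(S)-\Big(\frac{D_1(N)}{N}+K\Big)S+T\cdot h(S)=M .$$ -/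

import Mathlib

namespace LogTrans

/-- Exponents `(α, n₁, …, n_k) ∈ ℝ × ℤᵏ`, ordered lexicographically. -/
abbrev Exponent (k : ℕ) : Type := ℝ ×ₗ Lex (Fin k → ℤ)

/-- The exponent `(α, n)`. -/
def expo {k : ℕ} (α : ℝ) (n : Fin k → ℤ) : Exponent k := toLex (α, toLex n)

/-- The algebra `𝓛_k^∞` of logarithmic transseries of depth `k`: formal sums of real multiples of
`z ^ α * ℓ₁ ^ n₁ * ⋯ * ℓ_k ^ n_k` with well-ordered support in `ℝ × ℤᵏ`. The order `ord f` is
`f.orderTop`, the least element of the support (`⊤` for `f = 0`). -/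
abbrev LogTransseries (k : ℕ) : Type := HahnSeries (Exponent k) ℝ

/-- The iterated logarithm `ℓ_{j+1}`; the indices `j : Fin k` start from `0`, so `ell 0` is `ℓ₁`. -/
noncomputable def ell {k : ℕ} (j : Fin k) : LogTransseries k :=
  HahnSeries.single (expo 0 (Pi.single j 1)) 1

/-- Multiply the coefficient of the term of exponent `e` by `c e`, for every `e`. -/
def scaleCoeff {k : ℕ} (c : Exponent k → ℝ) (f : LogTransseries k) : LogTransseries k where
  coeff e := c e * f.coeff e
  isPWO_support' := f.isPWO_support.mono fun e he hf => he (by simp [hf])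

/-- The term-wise derivative `d/dℓ₁`. Since `ℓ_{j+1} = -1 / log ℓ_j` and `z = exp (-1 / ℓ₁)`, the
logarithmic derivatives with respect to `ℓ₁` of `ℓ_j` and of `z` are `ℓ₁⁻¹ * ℓ₂ * ⋯ * ℓ_j` and
`ℓ₁⁻²`, so that
`d/dℓ₁ (z ^ α * ℓ₁ ^ n₁ * ⋯ * ℓ_k ^ n_k)` is the product of `z ^ α * ℓ₁ ^ n₁ * ⋯ * ℓ_k ^ n_k` and
`α * ℓ₁⁻² + ∑ j, n_j * ℓ₁⁻¹ * ℓ₂ * ⋯ * ℓ_j`. -/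
noncomputable def derivEll1 {k : ℕ} [NeZero k] (f : LogTransseries k) : LogTransseries k :=
  (ell 0)⁻¹ ^ 2 * scaleCoeff (fun e => (ofLex e).1) f +
    ∑ j : Fin k, (ell 0)⁻¹ * (∏ i ∈ Finset.Ioc 0 j, ell i) *
      scaleCoeff (fun e => (ofLex (ofLex e).2 j : ℝ)) f

/-- The derivation `D₁ = ℓ₁² d/dℓ₁`. -/
noncomputable def D1 {k : ℕ} [NeZero k] (f : LogTransseries k) : LogTransseries k :=
  ell 0 ^ 2 * derivEll1 f

/-- Blocks of level one: transseries in `ℓ₁, …, ℓ_k` only, without powers of `z`. -/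
def Block1 (k : ℕ) : Set (LogTransseries k) :=
  {f | ∀ e ∈ f.support, (ofLex e).1 = 0}

/-- The set `𝓑_{≥1}^+` of blocks of level one of strictly positive order. -/
def Block1Pos (k : ℕ) : Set (LogTransseries k) :=
  {f | f ∈ Block1 k ∧ 0 < f.orderTop}

end LogTrans

open HahnSeries

/-! ### Equations over Hahn series, solved coefficient by coefficient. -/

namespace HahnSeries

variable {Γ R : Type*} [LinearOrder Γ]

/-! Put S = N U. The product rule cancels the term (D₁N / N) S and leaves D₁U + (T / N) h(N U) - K U
= M / N, with U of positive order.

On a monomial of positive exponent p, D₁ has leading exponent `shiftExp p` = p + (1, …, 1, 0, …, 0),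
where the ones stop at the first nonzero entry of p; that entry is the leading coefficient. The
shift is strictly increasing, is at most p + (1, …, 1), and its values are exactly the exponents
above (1, …, 1). The remaining terms in U raise the order of a difference U - V by more than (1, …,
1): for K this is assumed, and for h, which starts at x², the gain is ord T + ord N ≥ ord(D₁N) > (1,
…, 1). They therefore cannot affect the coefficient at `shiftExp p` when U - V starts at p or later
(`one_add_lt_orderTop_perturbation_sub`).

So each coefficient of U is determined by the earlier ones through a nonzero factor. This gives
uniqueness (`eq_of_coeff_sub_eq_mul`), and existence by gluing partial solutions
(`exists_eq_zero_of_coeff_sub_eq_mul`). -/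

theorem exists_first_coeff_ne [AddGroup R] {U V : R⟦Γ⟧} {p : Γ} (h : U.coeff p ≠ V.coeff p) :
    ∃ r ≤ p, U.coeff r ≠ V.coeff r ∧ ∀ q < r, U.coeff q = V.coeff q := by
  have hp : (U - V).coeff p ≠ 0 := by rw [coeff_sub]; exact sub_ne_zero.2 h
  obtain ⟨r, hr⟩ := WithTop.ne_top_iff_exists.1
    (orderTop_ne_top.2 fun h' : U - V = 0 => hp (by rw [h', coeff_zero]))
  refine ⟨r, ?_, ?_, fun q hq => ?_⟩
  · exact WithTop.coe_le_coe.1 (hr.trans_le (orderTop_le_of_coeff_ne_zero hp))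
  · rw [← sub_ne_zero, ← coeff_sub]
    exact coeff_orderTop_ne hr.symm
  · rw [← sub_eq_zero, ← coeff_sub]
    exact coeff_eq_zero_of_lt_orderTop (by rw [← hr]; exact_mod_cast hq)

theorem exists_first_coeff_ne_mem [AddGroup R] {P : Set Γ} {U V : R⟦Γ⟧} (hU : U.support ⊆ P)
    (hV : V.support ⊆ P) {p : Γ} (h : U.coeff p ≠ V.coeff p) :
    ∃ r ∈ P, r ≤ p ∧ U.coeff r ≠ V.coeff r ∧ ∀ q < r, U.coeff q = V.coeff q := by
  obtain ⟨r, hrp, hr, hlt⟩ := exists_first_coeff_ne h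
  refine ⟨r, ?_, hrp, hr, hlt⟩
  by_contra hP
  exact hr (by rw [not_not.1 fun h' => hP (hU h'), not_not.1 fun h' => hP (hV h')])

theorem eq_of_coeff_sub_eq_mul [Field R] {P : Set Γ} {θ : Γ → Γ} {c : Γ → R} {F : R⟦Γ⟧ → R⟦Γ⟧}
    (hc : ∀ p ∈ P, c p ≠ 0)
    (hF : ∀ U V : R⟦Γ⟧, U.support ⊆ P → V.support ⊆ P → ∀ p ∈ P,
      (∀ q < p, U.coeff q = V.coeff q) →
        (F U).coeff (θ p) - (F V).coeff (θ p) = c p * (U.coeff p - V.coeff p))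
    {U V : R⟦Γ⟧} (hU : U.support ⊆ P) (hV : V.support ⊆ P) (h : F U = F V) : U = V := by
  ext p
  by_contra hne
  obtain ⟨r, hr, -, hrne, hlt⟩ := exists_first_coeff_ne_mem hU hV hne
  have := hF U V hU hV r hr hlt
  rw [h, sub_self] at this
  exact mul_ne_zero (hc r hr) (sub_ne_zero.2 hrne) this.symm

/-- A map whose effect on the first changed coefficient is an invertible linear one has a zero:
the partial solutions are coherent, and they glue to a solution. -/
theorem exists_eq_zero_of_coeff_sub_eq_mul [Field R] {P : Set Γ} {θ : Γ → Γ} {c : Γ → R}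
    {F : R⟦Γ⟧ → R⟦Γ⟧} (hθ : StrictMonoOn θ P) (hc : ∀ p ∈ P, c p ≠ 0)
    (hF : ∀ U V : R⟦Γ⟧, U.support ⊆ P → V.support ⊆ P → ∀ p ∈ P,
      (∀ q < p, U.coeff q = V.coeff q) →
        (F U).coeff (θ p) - (F V).coeff (θ p) = c p * (U.coeff p - V.coeff p))
    (hFP : ∀ U : R⟦Γ⟧, U.support ⊆ P → (F U).support ⊆ θ '' P) :
    ∃ U : R⟦Γ⟧, U.support ⊆ P ∧ F U = 0 := by
  classical
  let good (p : Γ) (U : R⟦Γ⟧) : Prop :=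
    U.support ⊆ P ∧ ∀ q ∈ P, q ≤ p → (F U).coeff (θ q) = 0
  have good_mono {p q : Γ} {U : R⟦Γ⟧} (h : good p U) (hqp : q ≤ p) : good q U :=
    ⟨h.1, fun r hr hrq => h.2 r hr (hrq.trans hqp)⟩
  have coherent {p : Γ} {U V : R⟦Γ⟧} (hU : good p U) (hV : good p V) : U.coeff p = V.coeff p := by
    by_contra hne
    obtain ⟨r, hr, hrp, hrne, hlt⟩ := exists_first_coeff_ne_mem hU.1 hV.1 hne
    have := hF U V hU.1 hV.1 r hr hlt
    rw [hU.2 r hr hrp, hV.2 r hr hrp, sub_self] at this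
    exact mul_ne_zero (hc r hr) (sub_ne_zero.2 hrne) this.symm
  -- The candidate takes the common coefficient of all solutions up to p, and 0 where there is none.
  let w (p : Γ) : R := if h : ∃ U, good p U then h.choose.coeff p else 0
  have w_eq {p q : Γ} {U : R⟦Γ⟧} (h : good p U) (hqp : q ≤ p) : w q = U.coeff q := by
    have hex : ∃ U, good q U := ⟨U, good_mono h hqp⟩
    simp only [w, dif_pos hex]
    exact coherent hex.choose_spec (good_mono h hqp)
  have w_zero {p : Γ} (h : ¬ ∃ U, good p U) : w p = 0 := by simp only [w, dif_neg h]
  have hwf : (Function.support w).IsWF := by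
    rw [Set.isWF_iff_no_descending_seq]
    -- A descending sequence stays below its first term, where `w` agrees with a single series.
    intro f hf hmem
    obtain ⟨U, hU⟩ : ∃ U, good (f 0) U := by
      by_contra h
      exact hmem 0 (w_zero h)
    refine (Set.isWF_iff_no_descending_seq.1 U.isWF_support) f hf fun n => ?_
    have := hmem n
    rwa [Function.mem_support, w_eq hU (hf.antitone n.zero_le)] at this
  let W : R⟦Γ⟧ := ⟨w, hwf.isPWO⟩
  have hWP : W.support ⊆ P := by
    intro p hp
    obtain ⟨U, hU⟩ : ∃ U, good p U := by
      by_contra h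
      exact hp (w_zero h)
    refine hU.1 ?_
    change w p ≠ 0 at hp
    rwa [w_eq hU le_rfl] at hp
  have hWgood {p : Γ} {U : R⟦Γ⟧} (hp : p ∈ P) (hU : good p U) : (F W).coeff (θ p) = 0 := by
    have := hF W U hWP hU.1 p hp fun q hq => w_eq hU hq.le
    rwa [hU.2 p hp le_rfl, show W.coeff p = U.coeff p from w_eq hU le_rfl, sub_self, mul_zero,
      sub_zero] at this
  refine ⟨W, hWP, ?_⟩
  by_contra hne
  obtain ⟨r, hr⟩ := WithTop.ne_top_iff_exists.1 (orderTop_ne_top.2 hne)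
  obtain ⟨p, hp, rfl⟩ := hFP W hWP (coeff_orderTop_ne hr.symm)
  refine coeff_orderTop_ne hr.symm ?_
  -- If `θ p` were the leading exponent of `F W`, this correction would cancel that coefficient, so
  -- `W'` solves up to `p`; `hWgood` then makes the coefficient of `F W` vanish too.
  let W' := W + single p (-(F W).coeff (θ p) / c p)
  have hW'P : W'.support ⊆ P := by
    intro q hq
    by_cases h : q = p
    · exact h ▸ hp
    · refine hWP fun h' => hq ?_
      simp [W', h', coeff_single_of_ne h]
  have hW'W {q : Γ} (h : q < p) : W'.coeff q = W.coeff q := by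
    simp [W', coeff_single_of_ne h.ne]
  refine hWgood hp (U := W') ⟨hW'P, fun q hq hqp => ?_⟩
  have key := hF W' W hW'P hWP q hq fun s hs => hW'W (hs.trans_le hqp)
  rcases hqp.lt_or_eq with h | rfl
  · rw [hW'W h, sub_self, mul_zero, sub_eq_zero] at key
    rw [key]
    exact coeff_eq_zero_of_lt_orderTop (by rw [← hr]; exact_mod_cast hθ hq hp h)
  · have h1 : W'.coeff q - W.coeff q = -(F W).coeff (θ q) / c q := by simp [W']
    rw [h1, mul_div_cancel₀ _ (hc q hq)] at key
    linear_combination key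

end HahnSeries

/-! ### The shift of exponents under D₁. -/

namespace LogTrans

variable {k : ℕ}

theorem lt_iff_exists {e f : Exponent k} (he : (ofLex e).1 = 0) (hf : (ofLex f).1 = 0) :
    e < f ↔ ∃ i, (∀ j < i, ofLex (ofLex e).2 j = ofLex (ofLex f).2 j) ∧
      ofLex (ofLex e).2 i < ofLex (ofLex f).2 i := by
  rw [Prod.Lex.lt_iff, he, hf]
  simp only [lt_self_iff_false, true_and, false_or]
  exact Iff.rfl

theorem expo_le_expo {α : ℝ} {n m : Fin k → ℤ} (h : n ≤ m) : expo α n ≤ expo α m :=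
  Prod.Lex.toLex_le_toLex.2 (Or.inr ⟨rfl, Pi.toLex_monotone h⟩)

theorem expo_add_expo (α β : ℝ) (n m : Fin k → ℤ) :
    expo α n + expo β m = expo (α + β) (n + m) := rfl

/-- The exponent `(0, 1, …, 1, 0, …, 0)` of `ℓ₁ ⋯ ℓ_{j+1}`. -/
def initExp (j : Fin k) : Exponent k := expo 0 fun i => if i ≤ j then 1 else 0

theorem initExp_mono {i j : Fin k} (h : i ≤ j) : initExp i ≤ initExp j :=
  expo_le_expo fun l => by dsimp only; split_ifs <;> omega

theorem initExp_injective : Function.Injective (initExp (k := k)) := by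
  intro i j h
  have h' : ∀ l : Fin k, (if l ≤ i then (1 : ℤ) else 0) = if l ≤ j then 1 else 0 :=
    fun l => congrArg (fun e : Exponent k => ofLex (ofLex e).2 l) h
  have h1 := h' i
  have h2 := h' j
  simp only [le_refl, if_true] at h1 h2
  apply le_antisymm
  · by_contra hc; simp [hc] at h1
  · by_contra hc; simp [hc] at h2

theorem initExp_le_one (j : Fin k) : initExp j ≤ expo 0 1 :=
  expo_le_expo fun l => by dsimp only; split_ifs <;> simp

/-- The exponents of the monomials in `ℓ₁, …, ℓ_k` of positive order. -/
def posExp (k : ℕ) : Set (Exponent k) := {e | (ofLex e).1 = 0 ∧ 0 < e}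

theorem exists_first_ne_zero {e : Exponent k} (he : e ∈ posExp k) :
    ∃ j, 0 < ofLex (ofLex e).2 j ∧ ∀ i < j, ofLex (ofLex e).2 i = 0 := by
  have h := he.2
  rw [lt_iff_exists rfl he.1] at h
  obtain ⟨i, hi, hlt⟩ := h
  exact ⟨i, hlt, fun j hj => (hi j hj).symm⟩

open Classical in
/-- The index of the first nonzero entry of a positive exponent. -/
noncomputable def firstIdx [NeZero k] (e : Exponent k) : Fin k :=
  if h : ∃ j, 0 < ofLex (ofLex e).2 j ∧ ∀ i < j, ofLex (ofLex e).2 i = 0 then h.choose else 0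

variable [NeZero k]

theorem firstIdx_pos {e : Exponent k} (he : e ∈ posExp k) :
    0 < ofLex (ofLex e).2 (firstIdx e) := by
  rw [firstIdx, dif_pos (exists_first_ne_zero he)]
  exact (exists_first_ne_zero he).choose_spec.1

theorem eq_zero_of_lt_firstIdx {e : Exponent k} (he : e ∈ posExp k) {i : Fin k}
    (hi : i < firstIdx e) : ofLex (ofLex e).2 i = 0 := by
  rw [firstIdx, dif_pos (exists_first_ne_zero he)] at hi
  exact (exists_first_ne_zero he).choose_spec.2 i hi

theorem firstIdx_le {e : Exponent k} (he : e ∈ posExp k) {i : Fin k}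
    (hi : ofLex (ofLex e).2 i ≠ 0) : firstIdx e ≤ i := by
  by_contra h
  exact hi (eq_zero_of_lt_firstIdx he (not_le.1 h))

/-- The exponent of the leading term of the derivative `D₁` of the monomial of exponent `e`. -/
noncomputable def shiftExp (e : Exponent k) : Exponent k := e + initExp (firstIdx e)

theorem fst_shiftExp (e : Exponent k) : (ofLex (shiftExp e)).1 = (ofLex e).1 :=
  add_zero (ofLex e).1

theorem coord_shiftExp (e : Exponent k) (i : Fin k) :
    ofLex (ofLex (shiftExp e)).2 i = ofLex (ofLex e).2 i + if i ≤ firstIdx e then 1 else 0 := rfl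

/-- A larger positive exponent has its first nonzero entry no later. If the indices agree, both
exponents are translated equally; otherwise, at the earlier index, the smaller exponent gets 1 and
the larger at least 2. -/
theorem shiftExp_strictMonoOn : StrictMonoOn (shiftExp (k := k)) (posExp k) := by
  intro e he f hf hef
  have key : firstIdx f ≤ firstIdx e := by
    have h := hef
    rw [lt_iff_exists he.1 hf.1] at h
    obtain ⟨i, hi, hlt⟩ := h
    by_contra hc
    rw [not_le] at hc
    have h1 := firstIdx_pos he
    have h2 := eq_zero_of_lt_firstIdx hf hc
    rcases lt_trichotomy i (firstIdx e) with h | h | h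
    · rw [eq_zero_of_lt_firstIdx he h, eq_zero_of_lt_firstIdx hf (h.trans hc)] at hlt
      exact hlt.false
    · rw [h, h2] at hlt
      exact (h1.trans hlt).false
    · rw [hi _ h, h2] at h1
      exact h1.false
  rcases key.lt_or_eq with h | h
  · have h1 := firstIdx_pos hf
    have h2 := eq_zero_of_lt_firstIdx he h
    rw [lt_iff_exists ((fst_shiftExp e).trans he.1) ((fst_shiftExp f).trans hf.1)]
    refine ⟨firstIdx f, fun j hj => ?_, ?_⟩
    · rw [coord_shiftExp, coord_shiftExp, eq_zero_of_lt_firstIdx hf hj,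
        eq_zero_of_lt_firstIdx he (hj.trans h), if_pos hj.le, if_pos (hj.trans h).le]
    · rw [coord_shiftExp, coord_shiftExp, h2, if_pos h.le, if_pos le_rfl]
      omega
  · rw [shiftExp, shiftExp, h]
    exact add_lt_add_left hef _

theorem one_lt_shiftExp {e : Exponent k} (he : e ∈ posExp k) : expo 0 1 < shiftExp e := by
  rw [lt_iff_exists rfl ((fst_shiftExp e).trans he.1)]
  refine ⟨firstIdx e, fun j hj => ?_, ?_⟩
  · rw [coord_shiftExp, eq_zero_of_lt_firstIdx he hj, if_pos hj.le]
    rfl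
  · rw [coord_shiftExp, if_pos le_rfl]
    exact lt_add_of_pos_left _ (firstIdx_pos he)

theorem shiftExp_le (e : Exponent k) : shiftExp e ≤ e + expo 0 1 :=
  add_le_add_right (initExp_le_one _) _

/-- The first entry of q exceeding 1 is where the ones to be subtracted must stop. -/
theorem exists_shiftExp_eq {q : Exponent k} (hq : (ofLex q).1 = 0) (h : expo 0 1 < q) :
    ∃ e ∈ posExp k, shiftExp e = q := by
  have h' := h
  rw [lt_iff_exists rfl hq] at h'
  obtain ⟨i, hi, hlt⟩ := h'
  have hval (l : Fin k) : ofLex (ofLex (q - initExp i)).2 l =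
      ofLex (ofLex q).2 l - if l ≤ i then 1 else 0 := rfl
  have hi0 : 0 < ofLex (ofLex (q - initExp i)).2 i := by
    rw [hval, if_pos le_rfl]
    exact sub_pos.2 hlt
  have hlow (l : Fin k) (hl : l < i) : ofLex (ofLex (q - initExp i)).2 l = 0 := by
    rw [hval, if_pos hl.le, ← hi l hl]
    rfl
  have hfst : (ofLex (q - initExp i)).1 = 0 :=
    (sub_zero (ofLex q).1).trans hq
  have he : q - initExp i ∈ posExp k := by
    refine ⟨hfst, ?_⟩
    rw [lt_iff_exists rfl hfst]
    exact ⟨i, fun j hj => (hlow j hj).symm, hi0⟩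
  have hidx : firstIdx (q - initExp i) = i := by
    refine le_antisymm (firstIdx_le he hi0.ne') ?_
    by_contra hc
    exact (firstIdx_pos he).ne' (hlow _ (not_le.1 hc))
  exact ⟨q - initExp i, he, by rw [shiftExp, hidx, sub_add_cancel]⟩

theorem shiftExp_le_add_initExp {e : Exponent k} (he : e ∈ posExp k) {j : Fin k}
    (hj : ofLex (ofLex e).2 j ≠ 0) : shiftExp e ≤ e + initExp j :=
  add_le_add_right (initExp_mono (firstIdx_le he hj)) _

end LogTrans

/-! ### D₁ as a derivation, and its leading coefficients. -/

namespace LogTrans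

variable {k : ℕ}

theorem prod_ell (s : Finset (Fin k)) :
    ∏ i ∈ s, ell i = single (expo 0 fun i => if i ∈ s then 1 else 0 : Exponent k) (1 : ℝ) := by
  classical
  induction s using Finset.induction_on with
  | empty => simp; rfl
  | insert a s ha ih =>
    rw [Finset.prod_insert ha, ih, ell, single_mul_single, one_mul, expo_add_expo, add_zero]
    congr 2
    refine congrArg (expo 0) (funext fun i => ?_)
    rw [Pi.add_apply]
    by_cases h : i = a
    · subst h; simp [ha]
    · simp [h]

theorem scaleCoeff_mul {c : Exponent k → ℝ} (hc : ∀ a b, c (a + b) = c a + c b)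
    (f g : LogTransseries k) :
    scaleCoeff c (f * g) = scaleCoeff c f * g + f * scaleCoeff c g := by
  have hs (f : LogTransseries k) : (scaleCoeff c f).support ⊆ f.support := fun e he hf =>
    he (by simp [scaleCoeff, hf])
  ext e
  change c e * (f * g).coeff e = _
  rw [coeff_add, coeff_mul_left' f.isPWO_support (hs f), coeff_mul_right' g.isPWO_support (hs g),
    coeff_mul, Finset.mul_sum, ← Finset.sum_add_distrib]
  refine Finset.sum_congr rfl fun x hx => ?_
  simp only [Finset.mem_antidiagonal] at hx
  rw [← hx.2.2, hc]
  simp only [scaleCoeff]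
  ring

variable [NeZero k]

theorem D1_eq (f : LogTransseries k) :
    D1 f = scaleCoeff (fun e => (ofLex e).1) f +
      ∑ j : Fin k, single (initExp j) 1 * scaleCoeff (fun e => (ofLex (ofLex e).2 j : ℝ)) f := by
  have h0 : (ell 0 : LogTransseries k) ≠ 0 := by simp [ell]
  rw [D1, derivEll1, mul_add, ← mul_assoc, ← mul_pow, mul_inv_cancel₀ h0, one_pow, one_mul,
    Finset.mul_sum]
  congr 1
  refine Finset.sum_congr rfl fun j _ => ?_
  have hj : ell 0 * ∏ i ∈ Finset.Ioc 0 j, ell i = (single (initExp j) 1 : LogTransseries k) := by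
    rw [← Finset.prod_insert (by simp), Finset.Ioc_insert_left (Fin.zero_le _), prod_ell,
      initExp]
    simp
  rw [← hj]
  field_simp

theorem D1_mul (f g : LogTransseries k) : D1 (f * g) = D1 f * g + f * D1 g := by
  simp only [D1_eq]
  rw [scaleCoeff_mul fun a b => rfl]
  simp only [add_mul, mul_add, Finset.sum_mul, Finset.mul_sum]
  rw [add_add_add_comm, ← Finset.sum_add_distrib]
  congr 1
  refine Finset.sum_congr rfl fun j _ => ?_
  rw [scaleCoeff_mul fun a b => Int.cast_add _ _]
  ring

theorem coeff_D1 (f : LogTransseries k) (q : Exponent k) :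
    (D1 f).coeff q = (ofLex q).1 * f.coeff q +
      ∑ j : Fin k, (ofLex (ofLex (q - initExp j)).2 j : ℝ) * f.coeff (q - initExp j) := by
  simp only [D1_eq, coeff_add, coeff_sum, coeff_single_mul, one_mul]
  rfl

theorem D1_sub (f g : LogTransseries k) : D1 (f - g) = D1 f - D1 g := by
  ext q
  simp only [coeff_sub, coeff_D1, mul_sub, Finset.sum_sub_distrib]
  ring

theorem support_D1_subset {f : LogTransseries k} (hf : f.support ⊆ posExp k) :
    (D1 f).support ⊆ shiftExp '' posExp k := by
  intro q hq
  rw [mem_support, coeff_D1] at hq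
  have hmain {j : Fin k} (h : (ofLex (ofLex (q - initExp j)).2 j : ℝ) * f.coeff (q - initExp j) ≠ 0) :
      q ∈ shiftExp '' posExp k := by
    have he := hf (right_ne_zero_of_mul h)
    have hfst : (ofLex q).1 = 0 := (sub_zero (ofLex q).1).symm.trans he.1
    obtain ⟨e, he, h⟩ := exists_shiftExp_eq hfst <| (one_lt_shiftExp he).trans_le <|
      (shiftExp_le_add_initExp he (by exact_mod_cast left_ne_zero_of_mul h)).trans_eq
        (sub_add_cancel _ _)
    exact ⟨e, he, h⟩
  by_cases h : (ofLex q).1 * f.coeff q = 0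
  · rw [h, zero_add] at hq
    obtain ⟨j, -, hj⟩ := Finset.exists_ne_zero_of_sum_ne_zero hq
    exact hmain hj
  · exact absurd (hf (right_ne_zero_of_mul h)).1 (left_ne_zero_of_mul h)

/-- A contribution from another exponent e needs `shiftExp e ≤ shiftExp p`, hence e ≤ p by
monotonicity. As f vanishes below p, only e = p remains, which fixes the summand j. -/
theorem coeff_D1_shiftExp {f : LogTransseries k} (hf : f.support ⊆ posExp k) {p : Exponent k}
    (hp : p ∈ posExp k) (h : ∀ q < p, f.coeff q = 0) :
    (D1 f).coeff (shiftExp p) = ofLex (ofLex p).2 (firstIdx p) * f.coeff p := by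
  rw [coeff_D1, fst_shiftExp, hp.1, zero_mul, zero_add, Finset.sum_eq_single (firstIdx p)]
  · rw [shiftExp, add_sub_cancel_right]
  · intro j _ hj
    by_contra hne
    have he := hf (right_ne_zero_of_mul hne)
    have hj0 : ofLex (ofLex (shiftExp p - initExp j)).2 j ≠ 0 := by
      exact_mod_cast left_ne_zero_of_mul hne
    have hle := (shiftExp_le_add_initExp he hj0).trans_eq (sub_add_cancel _ _)
    have hpe : p = shiftExp p - initExp j :=
      le_antisymm (not_lt.1 fun hlt => right_ne_zero_of_mul hne (h _ hlt))
        ((shiftExp_strictMonoOn.le_iff_le he hp).1 hle)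
    refine hj (initExp_injective ?_)
    have h1 : p + initExp j = shiftExp p := by
      nth_rw 1 [hpe]
      exact sub_add_cancel _ _
    exact add_left_cancel h1
  · simp

theorem one_lt_orderTop_of_support_subset {f : LogTransseries k}
    (hf : f.support ⊆ shiftExp '' posExp k) :
    ((expo 0 1 : Exponent k) : WithTop (Exponent k)) < f.orderTop := by
  by_cases h0 : f = 0
  · simp [h0]
  · obtain ⟨r, hr⟩ := WithTop.ne_top_iff_exists.1 (orderTop_ne_top.2 h0)
    obtain ⟨p, hp, rfl⟩ := hf (coeff_orderTop_ne hr.symm)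
    rw [← hr]
    exact_mod_cast one_lt_shiftExp hp

end LogTrans

/-! ### Order estimates for substitution into a power series. -/

namespace HahnSeries

theorem le_orderTop_sum {Γ R ι : Type*} [LinearOrder Γ] [AddCommMonoid R] {s : Finset ι} {f : ι → R⟦Γ⟧} {a : WithTop Γ}
    (h : ∀ i ∈ s, a ≤ (f i).orderTop) : a ≤ (∑ i ∈ s, f i).orderTop := by
  rw [le_orderTop_iff_forall]
  intro j hj
  rw [coeff_sum]
  exact Finset.sum_eq_zero fun i hi => coeff_eq_zero_of_lt_orderTop (hj.trans_le (h i hi))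

variable {Γ R : Type*} [AddCommMonoid Γ] [LinearOrder Γ] [IsOrderedCancelAddMonoid Γ] [CommRing R]

theorem orderTop_pow_nonneg {x : R⟦Γ⟧} (hx : 0 ≤ x.orderTop) (n : ℕ) : 0 ≤ (x ^ n).orderTop := by
  induction n with
  | zero =>
    rw [pow_zero, le_orderTop_iff_forall]
    intro j hj
    rw [coeff_one, if_neg]
    rintro rfl
    exact hj.false
  | succ n ih =>
    rw [pow_succ]
    exact (add_nonneg ih hx).trans orderTop_add_le_mul

theorem le_orderTop_pow {x : R⟦Γ⟧} {a : WithTop Γ} (ha : 0 ≤ a) (hx : a ≤ x.orderTop) {n : ℕ}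
    (hn : n ≠ 0) : a ≤ (x ^ n).orderTop := by
  obtain ⟨m, rfl⟩ := Nat.exists_eq_succ_of_ne_zero hn
  rw [pow_succ]
  refine le_trans ?_ orderTop_add_le_mul
  calc a = 0 + a := (zero_add a).symm
    _ ≤ _ := add_le_add (orderTop_pow_nonneg (ha.trans hx) m) hx

/-- In xⁿ - yⁿ = (x - y) ∑ xⁱ yⁿ⁻¹⁻ⁱ every summand has degree n - 1 ≥ 1, so it contains a factor of
order at least a. -/
theorem le_orderTop_pow_sub_pow {x y : R⟦Γ⟧} {a : WithTop Γ} (ha : 0 ≤ a) (hx : a ≤ x.orderTop)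
    (hy : a ≤ y.orderTop) {n : ℕ} (hn : 2 ≤ n) :
    (x - y).orderTop + a ≤ (x ^ n - y ^ n).orderTop := by
  rw [← (Commute.all x y).mul_geom_sum₂ n]
  refine (add_le_add_right ?_ _).trans orderTop_add_le_mul
  refine le_orderTop_sum fun i hi => le_trans ?_ orderTop_add_le_mul
  rcases eq_or_ne i 0 with rfl | h
  · calc a = 0 + a := (zero_add a).symm
      _ ≤ _ := add_le_add (orderTop_pow_nonneg (ha.trans hx) _)
        (le_orderTop_pow ha hy (by omega))
  · calc a = a + 0 := (add_zero a).symm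
      _ ≤ _ := add_le_add (le_orderTop_pow ha hx h) (orderTop_pow_nonneg (ha.trans hy) _)

theorem coeff_heval_of_orderTop_pos {x : R⟦Γ⟧} (hx : 0 < x.orderTop) (h : PowerSeries R) (q : Γ) :
    (PowerSeries.heval x h).coeff q = ∑ᶠ n, PowerSeries.coeff n h • (x ^ n).coeff q := by
  rw [PowerSeries.coeff_heval]
  refine finsum_congr fun n => ?_
  change (SummableFamily.powerSeriesFamily x h n).coeff q = _
  rw [SummableFamily.powerSeriesFamily_of_orderTop_pos hx, coeff_smul]

theorem le_orderTop_heval_sub_heval {x y : R⟦Γ⟧} {a : WithTop Γ} (ha : 0 < a)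
    (hx : a ≤ x.orderTop) (hy : a ≤ y.orderTop) {h : PowerSeries R}
    (h0 : PowerSeries.coeff 0 h = 0) (h1 : PowerSeries.coeff 1 h = 0) :
    (x - y).orderTop + a ≤ (PowerSeries.heval x h - PowerSeries.heval y h).orderTop := by
  rw [le_orderTop_iff_forall]
  intro q hq
  rw [coeff_sub, sub_eq_zero, coeff_heval_of_orderTop_pos (ha.trans_le hx),
    coeff_heval_of_orderTop_pos (ha.trans_le hy)]
  refine finsum_congr fun n => ?_
  rcases lt_or_ge n 2 with hn | hn
  · interval_cases n <;> simp only [h0, h1, zero_smul]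
  · rw [← sub_eq_zero, ← smul_sub, ← coeff_sub,
      coeff_eq_zero_of_lt_orderTop (hq.trans_le (le_orderTop_pow_sub_pow ha.le hx hy hn)),
      smul_zero]

end HahnSeries

/-! ### The field of blocks of level one. -/

namespace LogTrans

variable {k : ℕ}

theorem toLex_zero_le_toLex_zero {n m : Lex (Fin k → ℤ)} :
    (toLex (0, n) : Exponent k) ≤ toLex (0, m) ↔ n ≤ m := by
  rw [Prod.Lex.toLex_le_toLex]
  simp only [lt_self_iff_false, true_and, false_or]

/-- The blocks of level one form a subfield of the transseries. -/
noncomputable def blockField (k : ℕ) : Subfield (LogTransseries k) :=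
  (embDomainRingHom (R := ℝ)
    (AddMonoidHom.mk' (fun n : Lex (Fin k → ℤ) => (toLex (0, n) : Exponent k))
      fun n m => congrArg (fun α : ℝ => toLex (α, n + m)) (add_zero 0).symm)
    (fun _ _ h => congrArg (fun e : Exponent k => (ofLex e).2) h)
    fun _ _ => toLex_zero_le_toLex_zero).fieldRange

theorem mem_blockField {f : LogTransseries k} : f ∈ blockField k ↔ f ∈ Block1 k := by
  constructor
  · rintro ⟨g, rfl⟩ e he
    obtain ⟨n, -, rfl⟩ := support_embDomain_subset he
    rfl
  · intro hf
    let ι : Lex (Fin k → ℤ) ↪o Exponent k :=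
      ⟨⟨fun n => toLex (0, n), fun n m h => congrArg (fun e : Exponent k => (ofLex e).2) h⟩,
        toLex_zero_le_toLex_zero⟩
    have hpwo : (Function.support fun n => f.coeff (ι n)).IsPWO := by
      refine Set.IsWF.isPWO ?_
      rw [Set.isWF_iff_no_descending_seq]
      intro u hu hmem
      exact Set.isWF_iff_no_descending_seq.1 f.isWF_support (fun n => ι (u n))
        (fun a b hab => ι.lt_iff_lt.2 (hu hab)) hmem
    refine ⟨⟨fun n => f.coeff (ι n), hpwo⟩, ?_⟩
    ext e
    change (embDomain ι _).coeff e = _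
    by_cases he : e ∈ Set.range ι
    · obtain ⟨n, rfl⟩ := he
      rw [embDomain_coeff]
    · rw [embDomain_of_notMem_range he]
      by_contra hne
      refine he ⟨(ofLex e).2, ?_⟩
      have := hf e (Ne.symm hne)
      change toLex (0, (ofLex e).2) = e
      rw [← this]
      rfl

theorem heval_mem_blockField {f : LogTransseries k} (hf : f ∈ blockField k)
    (h : PowerSeries ℝ) : PowerSeries.heval f h ∈ blockField k := by
  rw [mem_blockField]
  intro e he
  by_contra hne
  refine he ?_
  by_cases h0 : 0 < f.orderTop
  · rw [coeff_heval_of_orderTop_pos h0]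
    refine finsum_eq_zero_of_forall_eq_zero fun n => ?_
    rw [not_not.1 fun h' => hne (mem_blockField.1 (pow_mem hf n) e h'), smul_zero]
  -- Without positive order, `heval` takes a default value with no coefficient outside the exponent
  -- 0.
  · have h1 : e ≠ 0 := fun h => hne (by rw [h]; rfl)
    rw [PowerSeries.coeff_heval]
    refine finsum_eq_zero_of_forall_eq_zero fun n => ?_
    rcases eq_or_ne n 0 with rfl | hn <;> simp [*]

theorem mem_Block1Pos_iff {f : LogTransseries k} : f ∈ Block1Pos k ↔ f.support ⊆ posExp k := by
  constructor
  · rintro ⟨h1, h2⟩ e he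
    exact ⟨h1 e he, by exact_mod_cast h2.trans_le (orderTop_le_of_coeff_ne_zero he)⟩
  · refine fun h => ⟨fun e he => (h he).1, ?_⟩
    by_cases h0 : f = 0
    · simp [h0]
    · obtain ⟨r, hr⟩ := WithTop.ne_top_iff_exists.1 (orderTop_ne_top.2 h0)
      rw [← hr]
      exact_mod_cast (h (coeff_orderTop_ne hr.symm)).2

variable [NeZero k]

theorem support_subset_shiftExp_image {f : LogTransseries k} (hf : f ∈ blockField k)
    (h : ((expo 0 1 : Exponent k) : WithTop (Exponent k)) < f.orderTop) :
    f.support ⊆ shiftExp '' posExp k := fun q hq =>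
  let ⟨e, he, heq⟩ := exists_shiftExp_eq (mem_blockField.1 hf q hq)
    (by exact_mod_cast h.trans_le (orderTop_le_of_coeff_ne_zero hq))
  ⟨e, he, heq⟩

end LogTrans

/-! ### The equation for U = S / N. -/

namespace LogTrans

variable {k : ℕ}

/-- The part of the equation for `S / N` of higher order than `D₁`. -/
noncomputable def perturbation (K N T : LogTransseries k) (h : PowerSeries ℝ)
    (U : LogTransseries k) : LogTransseries k :=
  T / N * PowerSeries.heval (N * U) h - K * U

theorem perturbation_zero (K N T : LogTransseries k) {h : PowerSeries ℝ}
    (h0 : PowerSeries.coeff 0 h = 0) : perturbation K N T h 0 = 0 := by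
  have : PowerSeries.constantCoeff h = 0 := by simpa using h0
  rw [perturbation, mul_zero, mul_zero, sub_zero, PowerSeries.heval_apply,
    SummableFamily.powerSeriesFamily_hsum_zero, this, zero_smul, mul_zero]

theorem perturbation_mem_blockField {K N T U : LogTransseries k} (hK : K ∈ blockField k)
    (hN : N ∈ blockField k) (hT : T ∈ blockField k) (hU : U ∈ blockField k) (h : PowerSeries ℝ) :
    perturbation K N T h U ∈ blockField k :=
  sub_mem (mul_mem (div_mem hT hN) (heval_mem_blockField (mul_mem hN hU) h)) (mul_mem hK hU)

/-- Since h has no terms of degree below 2, h(N U) - h(N V) has order at least 2 ord N + ord(U - V);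
dividing by N leaves one ord N to combine with ord T. -/
theorem one_add_lt_orderTop_perturbation_sub {K N T U V : LogTransseries k}
    (hN0 : N ≠ 0) (hNpos : 0 < N.orderTop)
    (hK : ((expo 0 1 : Exponent k) : WithTop (Exponent k)) < K.orderTop)
    (hTN : ((expo 0 1 : Exponent k) : WithTop (Exponent k)) < T.orderTop + N.orderTop)
    (hU : 0 ≤ U.orderTop) (hV : 0 ≤ V.orderTop) {h : PowerSeries ℝ}
    (h0 : PowerSeries.coeff 0 h = 0) (h1 : PowerSeries.coeff 1 h = 0) {p : Exponent k}
    (hp : p ≤ (U - V).orderTop) :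
    ((expo 0 1 + p : Exponent k) : WithTop (Exponent k)) <
      (perturbation K N T h U - perturbation K N T h V).orderTop := by
  have heq : perturbation K N T h U - perturbation K N T h V =
      T / N * (PowerSeries.heval (N * U) h - PowerSeries.heval (N * V) h) + -K * (U - V) := by
    simp only [perturbation]; ring
  rw [heq, WithTop.coe_add]
  refine lt_of_lt_of_le (lt_min ?_ ?_) min_orderTop_le_orderTop_add
  · have hle {U : LogTransseries k} (hU : 0 ≤ U.orderTop) : N.orderTop ≤ (N * U).orderTop := by
      rw [orderTop_mul]
      exact le_add_of_nonneg_right hU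
    have h2 := le_orderTop_heval_sub_heval hNpos (hle hU) (hle hV) h0 h1
    rw [← mul_sub, orderTop_mul] at h2
    have h3 : T.orderTop = (T / N).orderTop + N.orderTop := by
      rw [← orderTop_mul, div_mul_cancel₀ _ hN0]
    rw [orderTop_mul]
    calc _ < T.orderTop + N.orderTop + (U - V).orderTop :=
          WithTop.add_lt_add_of_lt_of_le WithTop.coe_ne_top hTN hp
      _ = (T / N).orderTop + (N.orderTop + (U - V).orderTop + N.orderTop) := by
          rw [h3]; ac_rfl
      _ ≤ _ := add_le_add_right h2 _
  · rw [orderTop_mul, orderTop_neg]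
    exact WithTop.add_lt_add_of_lt_of_le WithTop.coe_ne_top hK hp

variable [NeZero k]

/-- The equation for `U = S / N`, in the form `residual U = 0`. -/
noncomputable def residual (K M N T : LogTransseries k) (h : PowerSeries ℝ)
    (U : LogTransseries k) : LogTransseries k :=
  D1 U + perturbation K N T h U - M / N

theorem mul_residual {K M N T U : LogTransseries k} {h : PowerSeries ℝ} (hN0 : N ≠ 0) :
    N * residual K M N T h U =
      D1 (N * U) - (D1 N / N + K) * (N * U) + T * PowerSeries.heval (N * U) h - M := by
  rw [residual, perturbation, D1_mul]
  field_simp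
  ring

theorem existsUnique_residual_eq_zero {K M N T : LogTransseries k}
    (hKB : K ∈ blockField k) (hMB : M ∈ blockField k) (hNB : N ∈ blockField k)
    (hTB : T ∈ blockField k) (hN0 : N ≠ 0) (hNpos : 0 < N.orderTop)
    (hK : ((expo 0 1 : Exponent k) : WithTop (Exponent k)) < K.orderTop)
    (hM : ((expo 0 1 : Exponent k) : WithTop (Exponent k)) < (M / N).orderTop)
    (hTN : ((expo 0 1 : Exponent k) : WithTop (Exponent k)) < T.orderTop + N.orderTop)
    {h : PowerSeries ℝ} (h0 : PowerSeries.coeff 0 h = 0) (h1 : PowerSeries.coeff 1 h = 0) :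
    ∃! U : LogTransseries k, U ∈ Block1Pos k ∧ residual K M N T h U = 0 := by
  have hc : ∀ p ∈ posExp k, (ofLex (ofLex p).2 (firstIdx p) : ℝ) ≠ 0 := fun p hp => by
    exact_mod_cast (firstIdx_pos hp).ne'
  have hF : ∀ U V : LogTransseries k, U.support ⊆ posExp k → V.support ⊆ posExp k →
      ∀ p ∈ posExp k, (∀ q < p, U.coeff q = V.coeff q) →
        (residual K M N T h U).coeff (shiftExp p) - (residual K M N T h V).coeff (shiftExp p) =
          (ofLex (ofLex p).2 (firstIdx p) : ℝ) * (U.coeff p - V.coeff p) := by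
    intro U V hU hV p hp hUV
    have hsub : (U - V).support ⊆ posExp k := (support_sub_subset _ _).trans (Set.union_subset hU hV)
    have hzero : ∀ q < p, (U - V).coeff q = 0 := fun q hq => by
      rw [coeff_sub, hUV q hq, sub_self]
    have hD := coeff_D1_shiftExp hsub hp hzero
    have hG : (perturbation K N T h U - perturbation K N T h V).coeff (shiftExp p) = 0 := by
      refine coeff_eq_zero_of_lt_orderTop (lt_of_le_of_lt ?_
        (one_add_lt_orderTop_perturbation_sub hN0 hNpos hK hTN (mem_Block1Pos_iff.2 hU).2.le
          (mem_Block1Pos_iff.2 hV).2.le h0 h1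
          (le_orderTop_iff_forall.2 fun q hq => hzero q (by exact_mod_cast hq))))
      rw [add_comm]
      exact_mod_cast shiftExp_le p
    rw [← coeff_sub, ← coeff_sub, ← hD, D1_sub]
    simp only [residual, coeff_sub, coeff_add] at hG ⊢
    linear_combination hG
  have hFP : ∀ U : LogTransseries k, U.support ⊆ posExp k →
      (residual K M N T h U).support ⊆ shiftExp '' posExp k := by
    intro U hU
    have hUB := mem_Block1Pos_iff.2 hU
    -- Comparison with V = 0, where the perturbation vanishes, bounds the order of the perturbation
    -- itself.
    have hG := one_add_lt_orderTop_perturbation_sub (U := U) (V := 0) (p := 0) hN0 hNpos hK hTN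
      hUB.2.le (by simp) h0 h1 (by rw [sub_zero]; exact_mod_cast hUB.2.le)
    rw [perturbation_zero K N T h0, sub_zero, add_zero] at hG
    have hGs := support_subset_shiftExp_image
      (perturbation_mem_blockField hKB hNB hTB (mem_blockField.2 hUB.1) h) hG
    have hMs := support_subset_shiftExp_image (div_mem hMB hNB) hM
    exact (support_sub_subset _ _).trans (Set.union_subset
      ((support_add_subset _ _).trans (Set.union_subset (support_D1_subset hU) hGs)) hMs)
  obtain ⟨U, hU, hres⟩ :=
    exists_eq_zero_of_coeff_sub_eq_mul shiftExp_strictMonoOn hc hF hFP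
  refine ⟨U, ⟨mem_Block1Pos_iff.2 hU, hres⟩, fun V hV => ?_⟩
  exact eq_of_coeff_sub_eq_mul hc hF (mem_Block1Pos_iff.1 hV.1) hU (hV.2.trans hres.symm)

end LogTrans

/-! ### Return from U to S = N U. -/

theorem mainTheorem4 (k : ℕ) [NeZero k] (K M N T : LogTrans.LogTransseries k)
    (hK : K ∈ LogTrans.Block1Pos k) (hM : M ∈ LogTrans.Block1Pos k)
    (hN : N ∈ LogTrans.Block1Pos k) (hT : T ∈ LogTrans.Block1Pos k)
    (hN0 : N ≠ 0)
    (hTord : (LogTrans.D1 N / N).orderTop ≤ T.orderTop)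
    (hKord : ((LogTrans.expo 0 1 : LogTrans.Exponent k) : WithTop (LogTrans.Exponent k)) < K.orderTop)
    (hMord : ((LogTrans.expo 0 1 : LogTrans.Exponent k) : WithTop (LogTrans.Exponent k)) < M.orderTop - N.orderTop)
    (h : PowerSeries ℝ) (h0 : PowerSeries.coeff 0 h = 0) (h1 : PowerSeries.coeff 1 h = 0) :
    ∃! S : LogTrans.LogTransseries k,
      S ∈ LogTrans.Block1Pos k ∧ N.orderTop < S.orderTop ∧
        LogTrans.D1 S - (LogTrans.D1 N / N + K) * S + T * PowerSeries.heval S h = M := by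
  open LogTrans in
  have hNB := mem_blockField.2 hN.1
  have hNtop : N.orderTop ≠ ⊤ := orderTop_ne_top.2 hN0
  have hMN : ((expo 0 1 : Exponent k) : WithTop (Exponent k)) < (M / N).orderTop := by
    have : M.orderTop = (M / N).orderTop + N.orderTop := by
      rw [← orderTop_mul, div_mul_cancel₀ _ hN0]
    rw [this] at hMord
    revert hMord
    generalize N.orderTop = a at hNtop
    generalize (M / N).orderTop = b
    lift a to Exponent k using hNtop
    cases b with
    | top => simp
    | coe b =>
      rw [← WithTop.coe_add, ← WithTop.LinearOrderedAddCommGroup.coe_sub, add_sub_cancel_right]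
      exact id
  have hTN : ((expo 0 1 : Exponent k) : WithTop (Exponent k)) < T.orderTop + N.orderTop := by
    -- The hypothesis on T gives ord T + ord N ≥ ord(D₁N), and D₁ sends positive blocks above (1, …,
    -- 1).
    refine (one_lt_orderTop_of_support_subset (support_D1_subset (mem_Block1Pos_iff.1 hN))).trans_le
      (le_trans ?_ (add_le_add_left hTord _))
    rw [← orderTop_mul, div_mul_cancel₀ _ hN0]
  -- The condition ord S > ord N is exactly what places U = S / N among the positive blocks, so both
  -- existence and uniqueness transfer.
  have hlt {U : LogTransseries k} : N.orderTop < (N * U).orderTop ↔ 0 < U.orderTop := by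
    rw [orderTop_mul]
    generalize N.orderTop = a at hNtop
    lift a to Exponent k using hNtop
    cases U.orderTop with
    | top => simp
    | coe b => norm_cast; exact lt_add_iff_pos_right a
  obtain ⟨U, ⟨hU, hres⟩, huniq⟩ := existsUnique_residual_eq_zero (mem_blockField.2 hK.1)
    (mem_blockField.2 hM.1) hNB (mem_blockField.2 hT.1) hN0 hN.2 hKord hMN hTN h0 h1
  have hNU := hlt.2 hU.2
  refine ⟨N * U, ⟨⟨mem_blockField.1 (mul_mem hNB (mem_blockField.2 hU.1)), hN.2.trans hNU⟩, hNU,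
    ?_⟩, ?_⟩
  · rw [← sub_eq_zero, ← mul_residual hN0, hres, mul_zero]
  · rintro S ⟨hS, hNS, heq⟩
    have hSN : N * (S / N) = S := mul_div_cancel₀ S hN0
    rw [← hSN] at hNS heq
    rw [← sub_eq_zero, ← mul_residual hN0] at heq
    rw [← huniq (S / N) ⟨⟨mem_blockField.1 (div_mem (mem_blockField.2 hS.1) hNB), hlt.1 hNS⟩,
      (mul_eq_zero.1 heq).resolve_left hN0⟩, hSN]
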